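/- Let $G$ be a probability measure on $[0,\infty)$. Give every vertical edge of the lattice $\mathbb Z^2$ the weight $1$ and every horizontal edge a random weight, independently with law $G$. For a nearest-neighbour path $p$ let $T(p)$ be the sum of the weights of its edges, for $a,b\in\mathbb Z^2$ let $T(a,b)=\inf_p T(p)$ over all paths $p$ from $a$ to $b$, and call $p$ a geodesic if it attains this infimum. A path is semi-directed if each of its steps lies in $\{(1,0),(0,1),(0,-1)\}$. For $v\ge 0$ let $\Lambda(v)$ be the deterministic almost sure limit of $\frac1n T((0,0),(n,\lceil vn\rceil))$ as $n\to\infty$, and put $\Lambda(-v)=\Lambda(v)$. Write $$\partial^+\Lambda(v)=\lim_{w\searrow v}\frac{\Lambda(w)-\Lambda(v)}{w-v},\qquad \partial^-\Lambda(v)=\lim_{w\nearrow v}\frac{\Lambda(v)-\Lambda(w)}{v-w}.$$ For a semi-directed path $p$ from $(0,0)$ to $(n,m)$ and $0\le k\le n$ let $(k,f_p(k))$ be the first point of $p$ on the line $\{k\}\times\mathbb Z$, and put $f_p(n+1)=m$. Let $U(p)$, $R(p)$ and $D(p)$ be the numbers of $k\in\{0,\dots,n\}$ with $f_p(k)<f_p(k+1)$,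 $f_p(k)=f_p(k+1)$ and $f_p(k)>f_p(k+1)$, respectively. **Theorem.** Suppose that $G$ is not a point mass. Then the limit $\Lambda(v)$ exists for every $v\ge 0$, and for every $v\ge0$ the one-sided derivatives $\partial^{\pm}\Lambda(v)$ exist and the following holds almost surely: for every choice of semi-directed geodesics $\gamma^n$ from $(0,0)$ to $(n,\lceil vn\rceil)$, $n\ge 0$, $$\partial^+\Lambda(v)\le\liminf_{n\to\infty}\frac1n\bigl(U(\gamma^n)+R(\gamma^n)-D(\gamma^n)\bigr)$$ and $$\partial^-\Lambda(v)\ge\limsup_{n\to\infty}\frac1n\bigl(U(\gamma^n)-R(\gamma^n)-D(\gamma^n)\bigr).$$ -/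

import Mathlib

open MeasureTheory Filter Topology
open scoped NNReal

noncomputable section

/-- The nearest-neighbour graph on `ℤ²`. -/
def latticeGraph : SimpleGraph (ℤ × ℤ) where
  Adj z w := |z.1 - w.1| + |z.2 - w.2| = 1
  symm := ⟨fun z w h => by rwa [abs_sub_comm w.1, abs_sub_comm w.2]⟩
  loopless := ⟨fun z h => by simp at h⟩

/-- A configuration of the weights of the horizontal edges of `ℤ²`: the weight of the edge between
`(x, y)` and `(x + 1, y)` is stored at its left endpoint `(x, y)`. -/
abbrev Environment : Type := ℤ × ℤ → ℝ≥0

/-- The law of the environment: the weights of the horizontal edges are independent with law `G`. -/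
def environmentLaw (G : Measure ℝ≥0) [IsProbabilityMeasure G] : Measure Environment :=
  Measure.infinitePi fun _ : ℤ × ℤ => G

/-- The weight of the edge between the neighbours `z` and `w`: vertical edges have weight `1`,
horizontal edges have the weight that the environment gives them. -/
def edgeWeight (F : Environment) (z w : ℤ × ℤ) : ℝ :=
  if z.1 = w.1 then 1 else (F (min z.1 w.1, z.2) : ℝ)

/-- The passage time of a path: the sum of the weights of its edges. -/
def pathTime (F : Environment) {a b : ℤ × ℤ} (p : latticeGraph.Walk a b) : ℝ :=
  (p.darts.map fun d => edgeWeight F d.fst d.snd).sum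

/-- The passage time between two points: the infimum over all paths that connect them. -/
def passageTime (F : Environment) (a b : ℤ × ℤ) : ℝ :=
  ⨅ p : latticeGraph.Walk a b, pathTime F p

/-- A geodesic is a path that attains the passage time between its endpoints. -/
def IsGeodesic (F : Environment) {a b : ℤ × ℤ} (p : latticeGraph.Walk a b) : Prop :=
  pathTime F p = passageTime F a b

/-- A path is (right) semi-directed if all of its steps go right, up or down. -/
def IsSemiDirected {a b : ℤ × ℤ} (p : latticeGraph.Walk a b) : Prop :=
  ∀ d ∈ p.darts, d.snd - d.fst = (1, 0) ∨ d.snd - d.fst = (0, 1) ∨ d.snd - d.fst = (0, -1)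

/-- The number `c` is the almost sure limit of `T((0,0), (n, ⌈v n⌉)) / n`. -/
def IsTimeConstant (G : Measure ℝ≥0) [IsProbabilityMeasure G] (v c : ℝ) : Prop :=
  ∀ᵐ F ∂(environmentLaw G),
    Tendsto (fun n : ℕ => passageTime F (0, 0) ((n : ℤ), ⌈v * (n : ℝ)⌉) / (n : ℝ)) atTop (𝓝 c)

/-- The time constant `Λ`: for `v ≥ 0` the almost sure limit of `T((0,0), (n, ⌈v n⌉)) / n`,
extended to all of `ℝ` by `Λ (-v) = Λ v`. -/
def timeConstant (G : Measure ℝ≥0) [IsProbabilityMeasure G] (v : ℝ) : ℝ :=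
  Classical.epsilon fun c : ℝ => IsTimeConstant G |v| c

/-- The heights `f_p(0), …, f_p(n+1)` of the pioneer points of a path `p` from the origin to
`(n, m)`: for `k ≤ n`, `f_p(k)` is the height at which `p` first visits the vertical line
`{k} × ℤ`, and `f_p(n+1) = m`. -/
def pioneerHeight {n : ℕ} {m : ℤ} (p : latticeGraph.Walk (0, 0) ((n : ℤ), m)) (k : ℕ) : ℤ :=
  if k ≤ n then (p.getVert (sInf {i : ℕ | (p.getVert i).1 = (k : ℤ)})).2 else m

/-- The number of up-turns. -/
def upTurns {n : ℕ} {m : ℤ} (p : latticeGraph.Walk (0, 0) ((n : ℤ), m)) : ℕ :=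
  ((Finset.range (n + 1)).filter fun k => pioneerHeight p k < pioneerHeight p (k + 1)).card

/-- The number of right-turns. -/
def rightTurns {n : ℕ} {m : ℤ} (p : latticeGraph.Walk (0, 0) ((n : ℤ), m)) : ℕ :=
  ((Finset.range (n + 1)).filter fun k => pioneerHeight p k = pioneerHeight p (k + 1)).card

/-- The number of down-turns. -/
def downTurns {n : ℕ} {m : ℤ} (p : latticeGraph.Walk (0, 0) ((n : ℤ), m)) : ℕ :=
  ((Finset.range (n + 1)).filter fun k => pioneerHeight p k > pioneerHeight p (k + 1)).card

end

/-! Shift the column of edges between `x` and `x + 1` up by `s * (x + 1)`, with `s = ±1`. The law of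
the i.i.d. weights does not change. A semi-directed geodesic whose pioneer heights are raised by `s
* k` crosses the same horizontal weights in the sheared environment. Only its vertical cost changes,
by `|d + s| - |d| = ±1` in a column where the height changes by `d`, and the turn counts add up
these signs. Hence the sheared passage time to height `m + s * n` is at most the geodesic time plus
`U + R - D` (for `s = 1`) or minus `U - R - D` (for `s = -1`), up to a constant:
`columnCost_shear_one_le`, `columnCost_shear_neg_one_le`. Dividing by `n` compares the turns with
`Λ(v + 1) - Λ(v)` and `Λ(v) - Λ(v - 1)`, and convexity of `Λ` compares these slopes with the
one-sided derivatives.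

The existence of `Λ` needs no moments of `G`. Left steps do not help, so the passage time is a
recursion over columns (`passageTime_eq_columnCost`). Vertical moves cost `1`, so a detour to a
cheap edge of a column has a geometric tail (`memLp_detourCost`). Means converge by subadditivity,
which also gives convexity (`convexOn_meanTimeConstant`). Efron–Stein over columns bounds the
variance linearly in `n` (`variance_columnCost_le`). This gives almost sure convergence along
squares, and monotonicity fills the gaps (`ae_tendsto_columnCost_div`). -/

/-- An upper bound for an infimum plus a constant. -/
theorem NNReal.le_iInf_add_of_forall_le {ι : Sort*} [Nonempty ι] {f : ι → ℝ≥0} {a b : ℝ≥0}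
    (h : ∀ i, b ≤ f i + a) : b ≤ (⨅ i, f i) + a :=
  tsub_le_iff_right.1 (le_ciInf fun i => tsub_le_iff_right.2 (h i))

theorem NNReal.iInf_le_apply {ι : Sort*} (f : ι → ℝ≥0) (i : ι) : ⨅ j, f j ≤ f i :=
  ciInf_le (OrderBot.bddBelow _) i

/-! ### Passage times computed column by column -/

/-- The passage time from `(x, y)` to `(x + n, m)`, computed column by column. -/
noncomputable def columnCost (F : Environment) (m : ℤ) : ℕ → ℤ → ℤ → ℝ≥0
  | 0, _, y => nndist y m
  | n + 1, x, y => ⨅ j : ℤ, (nndist y j + F (x, j) + columnCost F m n (x + 1) j)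

theorem columnCost_zero (F : Environment) (m x y : ℤ) : columnCost F m 0 x y = nndist y m := rfl

theorem columnCost_succ_le (F : Environment) (m : ℤ) (n : ℕ) (x y j : ℤ) :
    columnCost F m (n + 1) x y ≤ nndist y j + F (x, j) + columnCost F m n (x + 1) j :=
  NNReal.iInf_le_apply (fun j => nndist y j + F (x, j) + columnCost F m n (x + 1) j) j

theorem le_columnCost_succ {F : Environment} {m : ℤ} {n : ℕ} {x y : ℤ} {b : ℝ≥0}
    (h : ∀ j, b ≤ nndist y j + F (x, j) + columnCost F m n (x + 1) j) :
    b ≤ columnCost F m (n + 1) x y :=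
  le_ciInf h

theorem le_columnCost_succ_add {F : Environment} {m : ℤ} {n : ℕ} {x y : ℤ} {a b : ℝ≥0}
    (h : ∀ j, b ≤ nndist y j + F (x, j) + columnCost F m n (x + 1) j + a) :
    b ≤ columnCost F m (n + 1) x y + a :=
  NNReal.le_iInf_add_of_forall_le h

theorem columnCost_le_nndist_add (F : Environment) (m : ℤ) (n : ℕ) (x y y' : ℤ) :
    columnCost F m n x y ≤ nndist y y' + columnCost F m n x y' := by
  cases n with
  | zero => exact nndist_triangle _ _ _
  | succ n =>
    rw [add_comm (nndist y y')]
    refine le_columnCost_succ_add fun j => (columnCost_succ_le F m n x y j).trans ?_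
    have := nndist_triangle y y' j
    calc _ ≤ (nndist y y' + nndist y' j) + F (x, j) + columnCost F m n (x + 1) j := by gcongr
      _ = _ := by ring

theorem columnCost_target_le (F : Environment) (m m' : ℤ) (n : ℕ) (x y : ℤ) :
    columnCost F m n x y ≤ columnCost F m' n x y + nndist m m' := by
  induction n generalizing x y with
  | zero =>
    rw [nndist_comm m m']
    exact nndist_triangle _ _ _
  | succ n ih =>
    refine le_columnCost_succ_add fun j => (columnCost_succ_le F m n x y j).trans ?_
    rw [add_assoc _ _ (nndist m m')]
    gcongr
    exact ih _ _

/-- Skipping the first column lowers the passage time. -/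
theorem columnCost_le_columnCost_succ_left (F : Environment) (m : ℤ) (n : ℕ) (x y : ℤ) :
    columnCost F m n (x + 1) y ≤ columnCost F m (n + 1) x y := by
  refine le_columnCost_succ fun j => (columnCost_le_nndist_add F m n (x + 1) y j).trans ?_
  gcongr
  exact le_self_add

/-- Skipping the last column lowers the passage time. -/
theorem columnCost_le_columnCost_succ (F : Environment) (m : ℤ) (n : ℕ) (x y : ℤ) :
    columnCost F m n x y ≤ columnCost F m (n + 1) x y := by
  induction n generalizing x y with
  | zero =>
    exact le_columnCost_succ fun j => (nndist_triangle y j m).trans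
      (add_le_add_left le_self_add _)
  | succ n ih =>
    refine le_columnCost_succ fun j => (columnCost_succ_le F m n x y j).trans ?_
    gcongr
    exact ih _ _

theorem columnCost_add_le (F : Environment) (m m' : ℤ) (n n' : ℕ) (x y : ℤ) :
    columnCost F m' (n + n') x y ≤ columnCost F m n x y + columnCost F m' n' (x + n) m := by
  induction n generalizing x y with
  | zero => simpa [columnCost_zero] using columnCost_le_nndist_add F m' n' x y m
  | succ n ih =>
    rw [Nat.add_right_comm]
    refine le_columnCost_succ_add fun j => (columnCost_succ_le F m' (n + n') x y j).trans ?_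
    rw [add_assoc _ _ (columnCost F m' n' _ m)]
    gcongr
    have := ih (x + 1) j
    rwa [show x + 1 + (n : ℤ) = x + ((n + 1 : ℕ) : ℤ) by push_cast; ring] at this

/-- The cost of a detour from `(x, y)` through the column `x` to `(x + 1, y)`. -/
noncomputable def detourCost (F : Environment) (x y : ℤ) : ℝ≥0 :=
  ⨅ j : ℤ, (2 * nndist y j + F (x, j))

theorem detourCost_le (F : Environment) (x y j : ℤ) :
    detourCost F x y ≤ 2 * nndist y j + F (x, j) :=
  NNReal.iInf_le_apply (fun j => 2 * nndist y j + F (x, j)) j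

/-- Returning to height `y` after the crossing separates column `x` from the rest. This bounds what
a single column can contribute. -/
theorem columnCost_succ_le_detourCost_add (F : Environment) (m : ℤ) (n : ℕ) (x y : ℤ) :
    columnCost F m (n + 1) x y ≤ detourCost F x y + columnCost F m n (x + 1) y := by
  refine NNReal.le_iInf_add_of_forall_le fun j => (columnCost_succ_le F m n x y j).trans ?_
  have := columnCost_le_nndist_add F m n (x + 1) j y
  calc _ ≤ nndist y j + F (x, j) + (nndist j y + columnCost F m n (x + 1) y) := by gcongr
    _ = _ := by rw [nndist_comm j y]; ring

/-- The cost of following a path with prescribed pioneer heights. -/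
theorem columnCost_le_sum (F : Environment) (m : ℤ) (n : ℕ) (x : ℤ) (h : ℕ → ℤ) :
    columnCost F m n x (h 0) ≤
      ∑ k ∈ Finset.range n, (nndist (h k) (h (k + 1)) + F (x + k, h (k + 1))) +
        nndist (h n) m := by
  induction n generalizing x h with
  | zero => simp [columnCost_zero]
  | succ n ih =>
    refine (columnCost_succ_le F m n x (h 0) (h 1)).trans ?_
    rw [Finset.sum_range_succ']
    have := ih (x + 1) fun k => h (k + 1)
    have e : ∀ k : ℕ, x + 1 + (k : ℤ) = x + ((k + 1 : ℕ) : ℤ) := fun k => by push_cast; ring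
    simp only [e] at this
    refine (add_le_add_right this _).trans (le_of_eq ?_)
    simp only [Nat.cast_zero, add_zero, zero_add]
    ring

theorem columnCost_congr {F F' : Environment} {m : ℤ} {n : ℕ} {x : ℤ}
    (h : ∀ z : ℤ × ℤ, x ≤ z.1 → F z = F' z) (y : ℤ) :
    columnCost F m n x y = columnCost F' m n x y := by
  induction n generalizing x y with
  | zero => rfl
  | succ n ih =>
    refine iInf_congr fun j => ?_
    rw [h _ le_rfl, ih fun z hz => h z (by lia)]

theorem columnCost_translate (F : Environment) (a b m : ℤ) (n : ℕ) (x y : ℤ) :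
    columnCost (fun z => F (z.1 + a, z.2 + b)) m n x y =
      columnCost F (m + b) n (x + a) (y + b) := by
  induction n generalizing x y with
  | zero => simp [columnCost_zero]
  | succ n ih =>
    refine Equiv.iInf_congr (Equiv.addRight b) fun j => ?_
    simp [ih, add_right_comm x a 1]

theorem columnCost_reflect (F : Environment) (m : ℤ) (n : ℕ) (x y : ℤ) :
    columnCost (fun z => F (z.1, -z.2)) m n x y = columnCost F (-m) n x (-y) := by
  have e (a b : ℤ) : nndist (-a) (-b) = nndist a b := by
    ext; simp
  induction n generalizing x y with
  | zero => simp only [columnCost_zero, e]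
  | succ n ih =>
    refine Equiv.iInf_congr (Equiv.neg ℤ) fun j => ?_
    simp [ih, e]

theorem measurable_columnCost (m : ℤ) (n : ℕ) (x y : ℤ) :
    Measurable fun F => columnCost F m n x y := by
  induction n generalizing x y with
  | zero => exact measurable_const
  | succ n ih =>
    exact Measurable.iInf fun j => ((measurable_pi_apply _).const_add _).add (ih _ _)

theorem measurable_detourCost (x y : ℤ) : Measurable fun F => detourCost F x y :=
  Measurable.iInf fun _ => (measurable_pi_apply _).const_add _

/-! ### Walks, and the passage time as a column cost -/

theorem edgeWeight_nonneg (F : Environment) (z w : ℤ × ℤ) : 0 ≤ edgeWeight F z w := by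
  unfold edgeWeight
  split_ifs <;> positivity

theorem pathTime_nil (F : Environment) (a : ℤ × ℤ) :
    pathTime F (SimpleGraph.Walk.nil : latticeGraph.Walk a a) = 0 := by
  simp [pathTime]

theorem pathTime_cons (F : Environment) {a b c : ℤ × ℤ} (h : latticeGraph.Adj a b)
    (p : latticeGraph.Walk b c) :
    pathTime F (SimpleGraph.Walk.cons h p) = edgeWeight F a b + pathTime F p := by
  simp [pathTime]

theorem pathTime_append (F : Environment) {a b c : ℤ × ℤ} (p : latticeGraph.Walk a b)
    (q : latticeGraph.Walk b c) :
    pathTime F (p.append q) = pathTime F p + pathTime F q := by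
  simp [pathTime, SimpleGraph.Walk.darts_append]

theorem latticeGraph_adj_cases {a b : ℤ × ℤ} (h : latticeGraph.Adj a b) :
    b = (a.1 + 1, a.2) ∨ b = (a.1 - 1, a.2) ∨ b = (a.1, a.2 + 1) ∨ b = (a.1, a.2 - 1) := by
  obtain ⟨a₁, a₂⟩ := a
  obtain ⟨b₁, b₂⟩ := b
  simp only [latticeGraph, Prod.mk.injEq] at h ⊢
  rcases abs_cases (a₁ - b₁) with h₁ | h₁ <;> rcases abs_cases (a₂ - b₂) with h₂ | h₂ <;> lia

/-- The passage time from `a` to `b`, computed column by column, for `b` not to the left of `a`. -/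
noncomputable def columnTime (F : Environment) (a b : ℤ × ℤ) : ℝ≥0 :=
  columnCost F b.2 (b.1 - a.1).toNat a.1 a.2

/-- `columnTime` to a fixed target acts as a potential that drops along a step by at most the edge
weight, so its initial value bounds every walk from below, including walks with left steps. A left
step only adds a column. Right of the target `toNat` is `0`, and only vertical distance counts. -/
theorem columnTime_le_edgeWeight_add (F : Environment) {a a' : ℤ × ℤ}
    (h : latticeGraph.Adj a a') (b : ℤ × ℤ) :
    (columnTime F a b : ℝ) ≤ edgeWeight F a a' + columnTime F a' b := by
  obtain ⟨x, y⟩ := a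
  rcases latticeGraph_adj_cases h with rfl | rfl | rfl | rfl
  · have hw : edgeWeight F (x, y) (x + 1, y) = (F (x, y) : ℝ) := by simp [edgeWeight]
    rw [hw, ← NNReal.coe_add, NNReal.coe_le_coe]
    simp only [columnTime]
    rcases le_or_gt b.1 x with hb | hb
    · rw [Int.toNat_of_nonpos (by lia), Int.toNat_of_nonpos (by lia)]
      exact le_add_self
    · obtain ⟨n, hn⟩ := Int.eq_ofNat_of_zero_le (show 0 ≤ b.1 - (x + 1) by lia)
      rw [hn, show b.1 - x = ((n + 1 : ℕ) : ℤ) by push_cast; lia]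
      simpa using columnCost_succ_le F b.2 n x y y
  · refine le_add_of_nonneg_of_le (edgeWeight_nonneg _ _ _) (NNReal.coe_le_coe.2 ?_)
    simp only [columnTime]
    rcases lt_or_ge b.1 x with hb | hb
    · rw [Int.toNat_of_nonpos (by lia), Int.toNat_of_nonpos (by lia)]
      exact le_rfl
    · obtain ⟨n, hn⟩ := Int.eq_ofNat_of_zero_le (show 0 ≤ b.1 - x by lia)
      rw [hn, show b.1 - (x - 1) = ((n + 1 : ℕ) : ℤ) by push_cast; lia]
      simpa using columnCost_le_columnCost_succ_left F b.2 n (x - 1) y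
  · have := columnCost_le_nndist_add F b.2 (b.1 - x).toNat x y (y + 1)
    simpa [edgeWeight, columnTime, ← NNReal.coe_le_coe] using this
  · have := columnCost_le_nndist_add F b.2 (b.1 - x).toNat x y (y - 1)
    simpa [edgeWeight, columnTime, ← NNReal.coe_le_coe, Int.dist_eq] using this

theorem columnTime_le_pathTime (F : Environment) {a b : ℤ × ℤ} (p : latticeGraph.Walk a b) :
    (columnTime F a b : ℝ) ≤ pathTime F p := by
  induction p with
  | nil => simp [columnTime, columnCost_zero, pathTime_nil]
  | cons h p ih =>
    rw [pathTime_cons]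
    exact (columnTime_le_edgeWeight_add F h _).trans (by gcongr)

theorem pathTime_nonneg (F : Environment) {a b : ℤ × ℤ} (p : latticeGraph.Walk a b) :
    0 ≤ pathTime F p :=
  (NNReal.coe_nonneg _).trans (columnTime_le_pathTime F p)

theorem passageTime_le_pathTime (F : Environment) {a b : ℤ × ℤ} (p : latticeGraph.Walk a b) :
    passageTime F a b ≤ pathTime F p :=
  ciInf_le ⟨0, by rintro _ ⟨q, rfl⟩; exact pathTime_nonneg F q⟩ p

theorem exists_vertical_walk (F : Environment) (x y m : ℤ) :
    ∃ p : latticeGraph.Walk (x, y) (x, m), pathTime F p ≤ nndist y m := by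
  have up (n : ℕ) (y : ℤ) : ∃ p : latticeGraph.Walk (x, y) (x, y + n), pathTime F p = n := by
    induction n generalizing y with
    | zero => exact ⟨SimpleGraph.Walk.nil.copy rfl (by simp), by simp [pathTime]⟩
    | succ n ih =>
      obtain ⟨p, hp⟩ := ih (y + 1)
      have ha : latticeGraph.Adj (x, y) (x, y + 1) := by simp [latticeGraph]
      refine ⟨(SimpleGraph.Walk.cons ha p).copy rfl (by push_cast; ring_nf), ?_⟩
      have := pathTime_cons F ha p
      simp [pathTime, edgeWeight] at this hp ⊢
      rw [hp]; ring
  have down (n : ℕ) (y : ℤ) : ∃ p : latticeGraph.Walk (x, y) (x, y - n), pathTime F p = n := by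
    induction n generalizing y with
    | zero => exact ⟨SimpleGraph.Walk.nil.copy rfl (by simp), by simp [pathTime]⟩
    | succ n ih =>
      obtain ⟨p, hp⟩ := ih (y - 1)
      have ha : latticeGraph.Adj (x, y) (x, y - 1) := by simp [latticeGraph]
      refine ⟨(SimpleGraph.Walk.cons ha p).copy rfl (by push_cast; ring_nf), ?_⟩
      simp [pathTime, edgeWeight] at hp ⊢
      rw [hp]; ring
  rcases le_total y m with h | h
  · obtain ⟨n, hn⟩ := Int.eq_ofNat_of_zero_le (sub_nonneg.2 h)
    obtain rfl : m = y + n := by lia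
    obtain ⟨p, hp⟩ := up n y
    exact ⟨p, by simp [hp]⟩
  · obtain ⟨n, hn⟩ := Int.eq_ofNat_of_zero_le (sub_nonneg.2 h)
    obtain rfl : m = y - n := by lia
    obtain ⟨p, hp⟩ := down n y
    exact ⟨p, by simp [hp]⟩

/-- The slack `ε` pays for crossing heights that only nearly attain the infima. -/
theorem exists_walk_pathTime_le (F : Environment) (m : ℤ) (n : ℕ) (x y : ℤ) {ε : ℝ}
    (hε : 0 < ε) :
    ∃ p : latticeGraph.Walk (x, y) (x + n, m), pathTime F p ≤ columnCost F m n x y + ε := by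
  induction n generalizing x y ε with
  | zero =>
    obtain ⟨p, hp⟩ := exists_vertical_walk F x y m
    exact ⟨p.copy rfl (by simp), by simpa [pathTime, columnCost_zero] using hp.trans (by simp [hε.le])⟩
  | succ n ih =>
    obtain ⟨j, hj⟩ : ∃ j, (nndist y j + F (x, j) + columnCost F m n (x + 1) j : ℝ≥0) <
        columnCost F m (n + 1) x y + (ε / 2).toNNReal :=
      exists_lt_of_ciInf_lt (lt_add_of_pos_right _ (by simpa using hε))
    rw [← NNReal.coe_lt_coe] at hj
    push_cast [Real.coe_toNNReal _ (half_pos hε).le] at hj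
    obtain ⟨p, hp⟩ := exists_vertical_walk F x y j
    obtain ⟨q, hq⟩ := ih (x + 1) j (half_pos hε)
    have ha : latticeGraph.Adj (x, j) (x + 1, j) := by simp [latticeGraph]
    refine ⟨(p.append (SimpleGraph.Walk.cons ha q)).copy rfl (by push_cast; ring_nf), ?_⟩
    have h₁ := pathTime_append F p (SimpleGraph.Walk.cons ha q)
    have h₂ : edgeWeight F (x, j) (x + 1, j) = (F (x, j) : ℝ) := by simp [edgeWeight]
    rw [pathTime_cons, h₂] at h₁
    have h₃ : pathTime F ((p.append (SimpleGraph.Walk.cons ha q)).copy rfl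
        (by push_cast; ring_nf : (x + 1 + (n : ℤ), m) = (x + ((n + 1 : ℕ) : ℤ), m))) =
        pathTime F (p.append (SimpleGraph.Walk.cons ha q)) := by
      simp [pathTime]
    rw [h₃, h₁]
    rw [coe_nndist] at hp
    linarith

theorem passageTime_eq_columnCost (F : Environment) (n : ℕ) (m : ℤ) :
    passageTime F (0, 0) ((n : ℤ), m) = columnCost F m n 0 0 := by
  obtain ⟨p₀, -⟩ := exists_walk_pathTime_le F m n 0 0 one_pos
  have e : ((0 : ℤ) + n, m) = ((n : ℤ), m) := by simp
  have : Nonempty (latticeGraph.Walk (0, 0) ((n : ℤ), m)) := ⟨p₀.copy rfl e⟩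
  refine le_antisymm (le_of_forall_pos_le_add fun ε hε => ?_) (le_ciInf fun p => ?_)
  · obtain ⟨p, hp⟩ := exists_walk_pathTime_le F m n 0 0 hε
    refine (passageTime_le_pathTime F (p.copy rfl e)).trans ?_
    simpa [pathTime] using hp
  · simpa [columnTime] using columnTime_le_pathTime F p

/-! ### Pioneer heights of semi-directed walks -/

/-- The height at which a path first visits the vertical line through `x`. -/
noncomputable def hitHeight {a b : ℤ × ℤ} (p : latticeGraph.Walk a b) (x : ℤ) : ℤ :=
  (p.getVert (sInf {i : ℕ | (p.getVert i).1 = x})).2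

theorem hitHeight_start {a b : ℤ × ℤ} (p : latticeGraph.Walk a b) :
    hitHeight p a.1 = a.2 := by
  have : sInf {i : ℕ | (p.getVert i).1 = a.1} = 0 := Nat.sInf_eq_zero.2 (Or.inl (by simp))
  simp [hitHeight, this]

theorem exists_getVert_fst_eq {a b : ℤ × ℤ} (p : latticeGraph.Walk a b) {x : ℤ}
    (ha : a.1 ≤ x) (hb : x ≤ b.1) : ∃ i, (p.getVert i).1 = x := by
  induction p with
  | nil => exact ⟨0, by simpa using le_antisymm ha hb⟩
  | @cons a a' b h p ih =>
    rcases ha.eq_or_lt with rfl | ha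
    · exact ⟨0, by simp⟩
    · obtain ⟨i, hi⟩ := ih (by rcases latticeGraph_adj_cases h with rfl | rfl | rfl | rfl <;> grind) hb
      exact ⟨i + 1, by simpa using hi⟩

theorem hitHeight_cons {a a' b : ℤ × ℤ} (h : latticeGraph.Adj a a') (p : latticeGraph.Walk a' b)
    {x : ℤ} (ha : a.1 < x) (hb : x ≤ b.1) :
    hitHeight (SimpleGraph.Walk.cons h p) x = hitHeight p x := by
  have ha' : a'.1 ≤ x := by
    rcases latticeGraph_adj_cases h with rfl | rfl | rfl | rfl <;> grind
  -- The first coordinate changes by at most one per step, so the line is visited. The index sets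
  -- below are therefore nonempty, and `sInf` is a true first visit time.
  have hp := exists_getVert_fst_eq p ha' hb
  have key : sInf {i : ℕ | ((SimpleGraph.Walk.cons h p).getVert i).1 = x} =
      sInf {i : ℕ | (p.getVert i).1 = x} + 1 := by
    have hc : {i : ℕ | ((SimpleGraph.Walk.cons h p).getVert i).1 = x}.Nonempty :=
      hp.imp' (· + 1) fun i hi => by simpa using hi
    refine le_antisymm (Nat.sInf_le (by simpa using Nat.sInf_mem (s := {i | (p.getVert i).1 = x}) hp)) ?_
    have hm := Nat.sInf_mem hc
    rcases hs : sInf {i : ℕ | ((SimpleGraph.Walk.cons h p).getVert i).1 = x} with _ | i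
    · rw [hs] at hm
      simp at hm
      lia
    · rw [hs] at hm
      exact Nat.succ_le_succ (Nat.sInf_le (by simpa using hm))
  simp [hitHeight, key]

/-- Without left steps each column is crossed once, at the height where the next line is first hit.
The vertical steps in a column cost at least the difference of consecutive pioneer heights. -/
theorem sum_hitHeight_le_pathTime (F : Environment) {a b : ℤ × ℤ} (p : latticeGraph.Walk a b)
    (hp : IsSemiDirected p) (n : ℕ) (hn : a.1 + n = b.1) :
    ((∑ k ∈ Finset.range n, (nndist (hitHeight p (a.1 + k)) (hitHeight p (a.1 + (k + 1 : ℕ))) +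
      F (a.1 + k, hitHeight p (a.1 + (k + 1 : ℕ)))) +
        nndist (hitHeight p (a.1 + n)) b.2 : ℝ≥0) : ℝ) ≤ pathTime F p := by
  induction p generalizing n with
  | @nil a =>
    obtain rfl : n = 0 := by lia
    simp [pathTime_nil, hitHeight_start]
  | @cons a a' b h p ih =>
    have hp' : IsSemiDirected p := fun d hd => hp d (by simp [hd])
    have h₀ := hp ⟨(a, a'), h⟩ (by simp)
    have hH (k : ℕ) (hk : a.1 < a.1 + k) (hkn : k ≤ n) :
        hitHeight (SimpleGraph.Walk.cons h p) (a.1 + k) = hitHeight p (a.1 + k) :=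
      hitHeight_cons h p hk (by lia)
    -- An initial vertical step, up or down, changes only the first pioneer height. The triangle
    -- inequality absorbs it.
    have vert (hx : a'.1 = a.1) (hd : nndist a.2 a'.2 = 1) :
        ((∑ k ∈ Finset.range n, (nndist (hitHeight (SimpleGraph.Walk.cons h p) (a.1 + k))
          (hitHeight (SimpleGraph.Walk.cons h p) (a.1 + (k + 1 : ℕ))) +
          F (a.1 + k, hitHeight (SimpleGraph.Walk.cons h p) (a.1 + (k + 1 : ℕ)))) +
        nndist (hitHeight (SimpleGraph.Walk.cons h p) (a.1 + n)) b.2 : ℝ≥0) : ℝ) ≤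
        pathTime F (SimpleGraph.Walk.cons h p) := by
      have hw : edgeWeight F a a' = 1 := by simp [edgeWeight, hx]
      rw [pathTime_cons, hw]
      have := ih hp' n (by rw [hx, hn])
      refine le_trans ?_ (add_le_add_right this 1)
      rw [← NNReal.coe_one, ← NNReal.coe_add, NNReal.coe_le_coe, hx]
      have s₀ : hitHeight p a.1 = a'.2 := by rw [← hx, hitHeight_start]
      cases n with
      | zero =>
        simp only [Finset.range_zero, Finset.sum_empty, Nat.cast_zero, add_zero, zero_add,
          hitHeight_start, s₀, ← hd]
        exact nndist_triangle _ _ _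
      | succ n =>
        rw [Finset.sum_range_succ', Finset.sum_range_succ', hH (n + 1) (by lia) le_rfl]
        have hs : ∀ k ∈ Finset.range n, (nndist (hitHeight (SimpleGraph.Walk.cons h p)
            (a.1 + (k + 1 : ℕ))) (hitHeight (SimpleGraph.Walk.cons h p) (a.1 + (k + 1 + 1 : ℕ))) +
          F (a.1 + (k + 1 : ℕ), hitHeight (SimpleGraph.Walk.cons h p) (a.1 + (k + 1 + 1 : ℕ)))) =
          (nndist (hitHeight p (a.1 + (k + 1 : ℕ))) (hitHeight p (a.1 + (k + 1 + 1 : ℕ))) +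
          F (a.1 + (k + 1 : ℕ), hitHeight p (a.1 + (k + 1 + 1 : ℕ)))) := fun k hk => by
          rw [Finset.mem_range] at hk
          rw [hH (k + 1) (by lia) (by lia), hH (k + 1 + 1) (by lia) (by lia)]
        rw [Finset.sum_congr rfl hs, hH (0 + 1) (by lia) (by lia)]
        simp only [Nat.cast_zero, add_zero, hitHeight_start, s₀]
        have := nndist_triangle a.2 a'.2 (hitHeight p (a.1 + (0 + 1 : ℕ)))
        rw [hd] at this
        calc _ ≤ _ + ((1 + nndist a'.2 (hitHeight p (a.1 + (0 + 1 : ℕ)))) + _) + _ := by gcongr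
          _ = _ := by ring
    rcases h₀ with h₀ | h₀ | h₀
    · obtain rfl : a' = (a.1 + 1, a.2) := by
        rw [Prod.ext_iff] at h₀ ⊢; simp at h₀ ⊢; lia
      have hb : (a.1 + 1) ≤ b.1 := by
        have key {u w : ℤ × ℤ} (q : latticeGraph.Walk u w) (hq : IsSemiDirected q) :
            u.1 ≤ w.1 := by
          induction q with
          | nil => exact le_rfl
          | @cons u u' w h q ih =>
            refine le_trans ?_ (ih fun d hd => hq d (by simp [hd]))
            have := hq ⟨(u, u'), h⟩ (by simp)
            simp only [Prod.ext_iff, Prod.fst_sub, Prod.snd_sub] at this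
            lia
        exact key p hp'
      obtain ⟨n, rfl⟩ := Nat.exists_eq_add_one_of_ne_zero (show n ≠ 0 by lia)
      have := ih hp' n (by push_cast at hn; simp only; lia)
      have hw : edgeWeight F a (a.1 + 1, a.2) = (F a : ℝ) := by simp [edgeWeight]
      rw [pathTime_cons, hw]
      refine le_trans (le_of_eq ?_) (add_le_add_right this _)
      rw [← NNReal.coe_add]
      congr 1
      have hs : ∀ k ∈ Finset.range n, (nndist (hitHeight (SimpleGraph.Walk.cons h p)
          (a.1 + (k + 1 : ℕ))) (hitHeight (SimpleGraph.Walk.cons h p) (a.1 + (k + 1 + 1 : ℕ))) +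
        F (a.1 + (k + 1 : ℕ), hitHeight (SimpleGraph.Walk.cons h p) (a.1 + (k + 1 + 1 : ℕ)))) =
        (nndist (hitHeight p (a.1 + 1 + k)) (hitHeight p (a.1 + 1 + (k + 1 : ℕ))) +
        F (a.1 + 1 + k, hitHeight p (a.1 + 1 + (k + 1 : ℕ)))) := fun k hk => by
        rw [Finset.mem_range] at hk
        rw [hH (k + 1) (by lia) (by lia), hH (k + 1 + 1) (by lia) (by lia)]
        push_cast
        simp only [add_comm, add_left_comm]
      rw [Finset.sum_range_succ', Finset.sum_congr rfl hs, hH (0 + 1) (by lia) (by lia),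
        hH (n + 1) (by lia) le_rfl]
      have s₁ : hitHeight p (a.1 + (0 + 1 : ℕ)) = a.2 := by simpa using hitHeight_start p
      rw [s₁]
      simp only [Nat.cast_zero, add_zero, hitHeight_start, nndist_self, zero_add]
      rw [show a.1 + ((n + 1 : ℕ) : ℤ) = a.1 + 1 + n by push_cast; ring]
      ring
    · obtain rfl : a' = (a.1, a.2 + 1) := by
        rw [Prod.ext_iff] at h₀ ⊢; simp at h₀ ⊢; lia
      exact vert rfl (by ext; simp)
    · obtain rfl : a' = (a.1, a.2 - 1) := by
        rw [Prod.ext_iff] at h₀ ⊢; simp at h₀ ⊢; lia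
      exact vert rfl (by ext; simp)

/-! ### Turn counts and the shear -/

theorem upTurns_add_rightTurns_sub_downTurns {n : ℕ} {m : ℤ}
    (p : latticeGraph.Walk (0, 0) ((n : ℤ), m)) :
    (upTurns p : ℝ) + rightTurns p - downTurns p = ∑ k ∈ Finset.range (n + 1),
      if pioneerHeight p k ≤ pioneerHeight p (k + 1) then (1 : ℝ) else -1 := by
  simp only [upTurns, rightTurns, downTurns, Finset.card_filter, Nat.cast_sum]
  rw [← Finset.sum_add_distrib, ← Finset.sum_sub_distrib]
  refine Finset.sum_congr rfl fun k _ => ?_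
  rcases lt_trichotomy (pioneerHeight p k) (pioneerHeight p (k + 1)) with h | h | h
  · simp [h, h.le, h.ne, h.not_gt]
  · simp [h]
  · simp [h, h.ne', h.not_gt]

theorem upTurns_sub_rightTurns_sub_downTurns {n : ℕ} {m : ℤ}
    (p : latticeGraph.Walk (0, 0) ((n : ℤ), m)) :
    (upTurns p : ℝ) - rightTurns p - downTurns p = ∑ k ∈ Finset.range (n + 1),
      if pioneerHeight p k < pioneerHeight p (k + 1) then (1 : ℝ) else -1 := by
  simp only [upTurns, rightTurns, downTurns, Finset.card_filter, Nat.cast_sum]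
  rw [← Finset.sum_sub_distrib, ← Finset.sum_sub_distrib]
  refine Finset.sum_congr rfl fun k _ => ?_
  rcases lt_trichotomy (pioneerHeight p k) (pioneerHeight p (k + 1)) with h | h | h
  · simp [h, h.ne, h.not_gt]
  · simp [h]
  · simp [h, h.ne', h.not_gt]

/-- The environment in which the column of edges from `x` to `x + 1` is moved up by
`s * (x + 1)`. -/
def shear (s : ℤ) (F : Environment) : Environment :=
  fun z => F (z.1, z.2 - s * (z.1 + 1))

/-- The passage time in the sheared environment is bounded by following the sheared pioneer
heights of a semi-directed path. -/
theorem columnCost_shear_le (F : Environment) (s : ℤ) {n : ℕ} {m : ℤ}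
    (p : latticeGraph.Walk (0, 0) ((n : ℤ), m)) (hp : IsSemiDirected p) :
    (columnCost (shear s F) (m + s * n) n 0 0 : ℝ) ≤ pathTime F p +
      ∑ k ∈ Finset.range n,
        (|((pioneerHeight p (k + 1) - pioneerHeight p k + s : ℤ) : ℝ)| -
          |((pioneerHeight p (k + 1) - pioneerHeight p k : ℤ) : ℝ)|) := by
  have lower := sum_hitHeight_le_pathTime F p hp n (by simp)
  have hf (k : ℕ) (hk : k ≤ n) : hitHeight p k = pioneerHeight p k := by
    simp [pioneerHeight, hk, hitHeight]
  have upper := columnCost_le_sum (shear s F) (m + s * n) n 0 fun k => pioneerHeight p k + s * k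
  have h₀ : pioneerHeight p 0 = 0 := by
    rw [← hf 0 (Nat.zero_le _)]
    exact hitHeight_start p
  simp only [h₀, Nat.cast_zero, mul_zero, add_zero] at upper
  rw [← NNReal.coe_le_coe] at upper
  refine upper.trans (le_trans (le_of_eq ?_) (add_le_add_left lower _))
  simp only [zero_add]
  push_cast
  rw [add_right_comm, ← Finset.sum_add_distrib]
  congr 1
  · refine Finset.sum_congr rfl fun k hk => ?_
    rw [Finset.mem_range] at hk
    have e₁ := hf k hk.le
    have e₂ := hf (k + 1) hk
    push_cast at e₂
    rw [e₁, e₂]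
    simp only [shear, Int.dist_eq]
    push_cast
    rw [add_sub_cancel_right, abs_sub_comm, abs_sub_comm (pioneerHeight p k : ℝ)]
    ring_nf
  · rw [hf n le_rfl]
    simp [Int.dist_eq]

/-- For an integer `d`, `|d + 1| - |d|` is `1` if `d ≥ 0` and `-1` otherwise, so right-turns count
with up-turns. The final `1` covers the turn `k = n`, which has no column. -/
theorem columnCost_shear_one_le (F : Environment) {n : ℕ} {m : ℤ}
    (p : latticeGraph.Walk (0, 0) ((n : ℤ), m)) (hp : IsSemiDirected p) :
    (columnCost (shear 1 F) (m + n) n 0 0 : ℝ) ≤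
      pathTime F p + ((upTurns p : ℝ) + rightTurns p - downTurns p) + 1 := by
  have h := columnCost_shear_le F 1 p hp
  rw [one_mul] at h
  refine h.trans ?_
  rw [upTurns_add_rightTurns_sub_downTurns, Finset.sum_range_succ, add_assoc, add_assoc]
  gcongr
  refine le_add_of_le_of_nonneg (Finset.sum_le_sum fun k _ => ?_) (by split_ifs <;> norm_num)
  rw [← Int.cast_abs, ← Int.cast_abs, ← Int.cast_sub]
  split_ifs with hk
  · exact_mod_cast (by grind : |pioneerHeight p (k + 1) - pioneerHeight p k + 1| -
      |pioneerHeight p (k + 1) - pioneerHeight p k| ≤ 1)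
  · exact_mod_cast (by grind : |pioneerHeight p (k + 1) - pioneerHeight p k + 1| -
      |pioneerHeight p (k + 1) - pioneerHeight p k| ≤ -1)

/-- Here `|d - 1| - |d|` is `-1` if `d > 0` and `1` otherwise, so right-turns count with down-turns.
-/
theorem columnCost_shear_neg_one_le (F : Environment) {n : ℕ} {m : ℤ}
    (p : latticeGraph.Walk (0, 0) ((n : ℤ), m)) (hp : IsSemiDirected p) :
    (columnCost (shear (-1) F) (m - n) n 0 0 : ℝ) ≤
      pathTime F p - ((upTurns p : ℝ) - rightTurns p - downTurns p) + 1 := by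
  have h := columnCost_shear_le F (-1) p hp
  rw [neg_one_mul, ← sub_eq_add_neg] at h
  refine h.trans ?_
  rw [upTurns_sub_rightTurns_sub_downTurns, Finset.sum_range_succ, sub_eq_add_neg, add_assoc,
    neg_add, add_assoc, ← Finset.sum_neg_distrib]
  gcongr
  refine le_add_of_le_of_nonneg (Finset.sum_le_sum fun k _ => ?_) (by split_ifs <;> norm_num)
  rw [← Int.cast_abs, ← Int.cast_abs, ← Int.cast_sub]
  split_ifs with hk
  · exact_mod_cast (by grind : |pioneerHeight p (k + 1) - pioneerHeight p k + -1| -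
      |pioneerHeight p (k + 1) - pioneerHeight p k| ≤ -1)
  · rw [neg_neg]
    exact_mod_cast (by grind : |pioneerHeight p (k + 1) - pioneerHeight p k + -1| -
      |pioneerHeight p (k + 1) - pioneerHeight p k| ≤ 1)

/-! ### Invariance of the law and resampling of a column -/

instance (G : Measure ℝ≥0) [IsProbabilityMeasure G] : IsProbabilityMeasure (environmentLaw G) := by
  unfold environmentLaw; infer_instance

theorem measurePreserving_reindex (G : Measure ℝ≥0) [IsProbabilityMeasure G]
    (e : ℤ × ℤ ≃ ℤ × ℤ) :
    MeasurePreserving (fun (F : Environment) z => F (e z)) (environmentLaw G)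
      (environmentLaw G) := by
  have hm : Measurable fun (F : Environment) z => F (e z) :=
    measurable_pi_lambda _ fun z => measurable_pi_apply _
  refine ⟨hm, Measure.eq_infinitePi _ fun s t ht => ?_⟩
  rw [Measure.map_apply hm (.pi s.countable_toSet fun i _ => ht i)]
  have : (fun (F : Environment) z => F (e z)) ⁻¹' (Set.pi s t) =
      Set.pi (s.map e.toEmbedding) fun z => t (e.symm z) := by
    ext F
    simp only [Set.mem_preimage, Set.mem_pi, SetLike.mem_coe, Finset.mem_map_equiv]
    exact e.forall_congr (by simp)
  rw [this, environmentLaw, Measure.infinitePi_pi _ fun i _ => ht _, Finset.prod_map]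
  simp

theorem integral_reindex (G : Measure ℝ≥0) [IsProbabilityMeasure G] (e : ℤ × ℤ ≃ ℤ × ℤ)
    {f : Environment → ℝ} (hf : Measurable f) :
    ∫ F, f (fun z => F (e z)) ∂(environmentLaw G) = ∫ F, f F ∂(environmentLaw G) := by
  have hp := measurePreserving_reindex G e
  conv_rhs => rw [← hp.map_eq]
  exact (integral_map hp.measurable.aemeasurable hf.aestronglyMeasurable).symm

/-- The environment `F` with the column of edges from `x` to `x + 1` replaced by that of `F'`. -/
def replaceColumn (x : ℤ) (F F' : Environment) : Environment :=
  fun z => if z.1 = x then F' z else F z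

theorem measurable_replaceColumn (x : ℤ) :
    Measurable fun p : Environment × Environment => replaceColumn x p.1 p.2 := by
  refine measurable_pi_lambda _ fun z => ?_
  unfold replaceColumn
  split_ifs
  · exact (measurable_pi_apply z).comp measurable_snd
  · exact (measurable_pi_apply z).comp measurable_fst

theorem measurePreserving_replaceColumn (G : Measure ℝ≥0) [IsProbabilityMeasure G] (x : ℤ) :
    MeasurePreserving (fun p : Environment × Environment => replaceColumn x p.1 p.2)
      ((environmentLaw G).prod (environmentLaw G)) (environmentLaw G) := by
  refine ⟨measurable_replaceColumn x, Measure.eq_infinitePi _ fun s t ht => ?_⟩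
  rw [Measure.map_apply (measurable_replaceColumn x) (.pi s.countable_toSet fun i _ => ht i)]
  have : (fun p : Environment × Environment => replaceColumn x p.1 p.2) ⁻¹' (Set.pi s t) =
      (Set.pi (s.filter fun z => ¬ z.1 = x) t) ×ˢ (Set.pi (s.filter fun z => z.1 = x) t) := by
    ext ⟨F, F'⟩
    simp only [Set.mem_preimage, Set.mem_pi, Set.mem_prod, Finset.coe_filter, Set.mem_ofPred_eq,
      SetLike.mem_coe, replaceColumn]
    grind
  rw [this, Measure.prod_prod, environmentLaw, Measure.infinitePi_pi _ fun i _ => ht _,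
    Measure.infinitePi_pi _ fun i _ => ht _, mul_comm, Finset.prod_filter_mul_prod_filter_not]

/-! ### Second moments -/

theorem exists_measure_Ioi_lt_one (G : Measure ℝ≥0) [IsProbabilityMeasure G] :
    ∃ M : ℝ≥0, G (Set.Ioi M) < 1 := by
  by_contra! h
  have hG : Tendsto (fun n : ℕ => G (Set.Ioi (n : ℝ≥0))) atTop (𝓝 (G (⋂ n : ℕ, Set.Ioi (n : ℝ≥0)))) :=
    tendsto_measure_iInter_atTop (fun n => measurableSet_Ioi.nullMeasurableSet)
      (fun a b hab => Set.Ioi_subset_Ioi (by exact_mod_cast hab)) ⟨0, measure_ne_top _ _⟩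
  have he : (⋂ n : ℕ, Set.Ioi (n : ℝ≥0)) = ∅ := by
    ext x
    obtain ⟨n, hn⟩ := exists_nat_ge x
    simpa using ⟨n, hn⟩
  rw [he, measure_empty] at hG
  have := ge_of_tendsto' hG fun n => h n
  simp at this

/-- Going up from `y` to the first edge of weight at most `M` gives a detour of cost at most `2 * t
+ M`, where `t` edges have been rejected. That event has probability `G (Set.Ioi M) ^ t`, and the
geometric decay beats the square. -/
theorem lintegral_detourCost_sq_lt_top (G : Measure ℝ≥0) [IsProbabilityMeasure G] (x y : ℤ) :
    ∫⁻ F, (detourCost F x y : ENNReal) ^ 2 ∂(environmentLaw G) < ⊤ := by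
  obtain ⟨M, hM⟩ := exists_measure_Ioi_lt_one G
  set E : ℕ → Set Environment := fun t =>
    Set.pi ((Finset.range t).image fun i : ℕ => (x, y + (i : ℤ))) fun _ => Set.Ioi M with hE
  have hEm (t : ℕ) : MeasurableSet (E t) :=
    .pi (Finset.countable_toSet _) fun _ _ => measurableSet_Ioi
  have hEv (t : ℕ) : environmentLaw G (E t) = G (Set.Ioi M) ^ t := by
    rw [hE, environmentLaw, Measure.infinitePi_pi _ fun _ _ => measurableSet_Ioi,
      Finset.prod_const, Finset.card_image_of_injective _ fun a b h => by simpa using h,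
      Finset.card_range]
  have bound (F : Environment) : (detourCost F x y : ENNReal) ^ 2 ≤
      ∑' t : ℕ, (E t).indicator (fun _ => ((2 * t + M : ℝ≥0) : ENNReal) ^ 2) F := by
    have key (t : ℕ) (ht : ∀ i < t, M < F (x, y + i)) (hd : detourCost F x y ≤ 2 * t + M) :
        (detourCost F x y : ENNReal) ^ 2 ≤
        ∑' t : ℕ, (E t).indicator (fun _ => ((2 * t + M : ℝ≥0) : ENNReal) ^ 2) F := by
      refine le_trans ?_ (ENNReal.le_tsum t)
      have : F ∈ E t := by simpa [hE, Set.mem_pi] using ht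
      rw [Set.indicator_of_mem this]
      gcongr
    by_cases h : ∃ i : ℕ, F (x, y + i) ≤ M
    · refine key (Nat.find h) (fun i hi => not_le.1 (Nat.find_min h hi)) ?_
      refine (detourCost_le F x y (y + Nat.find h)).trans (add_le_add (le_of_eq ?_) (Nat.find_spec h))
      congr 1
      ext; simp
    -- If every edge above is heavy, `F` lies in all `E t`. Any `t ≥ F (x, y)` then works with the
    -- direct crossing, so no null set has to be removed.
    · push Not at h
      obtain ⟨t, ht⟩ := exists_nat_ge (F (x, y))
      refine key t (fun i _ => h i) ((detourCost_le F x y y).trans ?_)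
      rw [nndist_self, mul_zero, zero_add]
      exact ht.trans (le_add_right (le_mul_of_one_le_left' one_le_two))
  refine (lintegral_mono bound).trans_lt ?_
  rw [lintegral_tsum fun t => (measurable_const.indicator (hEm t)).aemeasurable]
  simp only [lintegral_indicator_const (hEm _), hEv]
  obtain ⟨q, hq⟩ : ∃ q : ℝ≥0, (q : ENNReal) = G (Set.Ioi M) :=
    ⟨_, ENNReal.coe_toNNReal (measure_ne_top _ _)⟩
  rw [← hq] at hM ⊢
  have hq1 : (q : ℝ) < 1 := by exact_mod_cast hM
  have hsum : Summable fun t : ℕ => (2 * t + M : ℝ≥0) ^ 2 * q ^ t := by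
    rw [← NNReal.summable_coe]
    push_cast
    have hn : ‖(q : ℝ)‖ < 1 := by simpa using hq1
    have h0 := summable_pow_mul_geometric_of_norm_lt_one 0 hn
    have h1 := summable_pow_mul_geometric_of_norm_lt_one 1 hn
    have h2 := summable_pow_mul_geometric_of_norm_lt_one 2 hn
    refine (((h2.mul_left 4).add (h1.mul_left (4 * (M : ℝ)))).add (h0.mul_left ((M : ℝ) ^ 2))).congr fun t => ?_
    ring
  have := ENNReal.tsum_coe_ne_top_iff_summable.2 hsum
  push_cast at this ⊢
  exact this.lt_top

theorem memLp_detourCost (G : Measure ℝ≥0) [IsProbabilityMeasure G] (x y : ℤ) :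
    MemLp (fun F => (detourCost F x y : ℝ)) 2 (environmentLaw G) := by
  refine ⟨(measurable_detourCost x y).coe_nnreal_real.aestronglyMeasurable, ?_⟩
  rw [eLpNorm_lt_top_iff_lintegral_rpow_enorm_lt_top two_ne_zero ENNReal.ofNat_ne_top]
  simpa using lintegral_detourCost_sq_lt_top G x y

theorem memLp_columnCost (G : Measure ℝ≥0) [IsProbabilityMeasure G] (m : ℤ) (n : ℕ) (x y : ℤ) :
    MemLp (fun F => (columnCost F m n x y : ℝ)) 2 (environmentLaw G) := by
  induction n generalizing x with
  | zero => exact memLp_const _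
  | succ n ih =>
    refine ((memLp_detourCost G x y).add (ih (x + 1))).mono
      (measurable_columnCost m (n + 1) x y).coe_nnreal_real.aestronglyMeasurable
      (Eventually.of_forall fun F => ?_)
    rw [Real.norm_of_nonneg (by positivity), Pi.add_apply, Real.norm_of_nonneg (by positivity)]
    exact_mod_cast columnCost_succ_le_detourCost_add F m n x y

/-! ### Efron–Stein for two independent variables -/

section ProductVariance

open ProbabilityTheory

variable {α β : Type*} [MeasurableSpace α] [MeasurableSpace β] {μ : Measure α} {ν : Measure β}
  [IsProbabilityMeasure μ] [IsProbabilityMeasure ν] {φ : α × β → ℝ}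

theorem sq_integral_le_integral_sq {f : α → ℝ} (hf : MemLp f 2 μ) :
    (∫ x, f x ∂μ) ^ 2 ≤ ∫ x, f x ^ 2 ∂μ := by
  have := variance_nonneg f μ
  rw [variance_eq_sub hf] at this
  simpa using this

theorem memLp_integral_prod_left (hφ : MemLp φ 2 (μ.prod ν))
    (hx : ∀ x, MemLp (fun y => φ (x, y)) 2 ν) :
    MemLp (fun x => ∫ y, φ (x, y) ∂ν) 2 μ := by
  have hm := (hφ.integrable one_le_two).integral_prod_left.aestronglyMeasurable
  refine (memLp_two_iff_integrable_sq hm).2 ?_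
  refine hφ.integrable_sq.integral_prod_left.mono (hm.pow 2) (Eventually.of_forall fun x => ?_)
  rw [Real.norm_of_nonneg (sq_nonneg _),
    Real.norm_of_nonneg (integral_nonneg fun y => sq_nonneg _)]
  exact sq_integral_le_integral_sq (hx x)

/-- The Efron–Stein inequality for two variables. -/
theorem variance_prod_le (hφ : MemLp φ 2 (μ.prod ν))
    (hx : ∀ x, MemLp (fun y => φ (x, y)) 2 ν) (hy : ∀ y, MemLp (fun x => φ (x, y)) 2 μ)
    {B₁ B₂ : ℝ} (h₁ : ∀ y, Var[fun x => φ (x, y); μ] ≤ B₁)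
    (h₂ : ∀ x, Var[fun y => φ (x, y); ν] ≤ B₂) :
    Var[φ; μ.prod ν] ≤ B₁ + B₂ := by
  -- The variance is the mean conditional variance given `x`, bounded in `e₂`, plus the variance of
  -- the partial mean `h`, bounded in `e₁`: the centred `h x` is the `y`-average of `φ (x, y) - k
  -- y`, so Jensen and Fubini apply.
  set h : α → ℝ := fun x => ∫ y, φ (x, y) ∂ν with hh
  set k : β → ℝ := fun y => ∫ x, φ (x, y) ∂μ with hk
  have hi := hφ.integrable one_le_two
  have hL : MemLp h 2 μ := memLp_integral_prod_left hφ hx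
  have hφs : MemLp (fun p : β × α => φ (p.2, p.1)) 2 (ν.prod μ) :=
    hφ.comp_measurePreserving (Measure.measurePreserving_swap)
  have kL : MemLp k 2 ν := memLp_integral_prod_left hφs hy
  have mean_h : ∫ p, φ p ∂(μ.prod ν) = ∫ x, h x ∂μ := integral_prod _ hi
  have mean_k : ∫ x, h x ∂μ = ∫ y, k y ∂ν := integral_integral_swap hi
  have e₂ : ∫ p, φ p ^ 2 ∂(μ.prod ν) ≤ B₂ + ∫ x, h x ^ 2 ∂μ := by
    rw [integral_prod _ hφ.integrable_sq]
    calc ∫ x, ∫ y, φ (x, y) ^ 2 ∂ν ∂μ ≤ ∫ x, (B₂ + h x ^ 2) ∂μ := by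
          refine integral_mono hφ.integrable_sq.integral_prod_left
            ((integrable_const _).add hL.integrable_sq) fun x => ?_
          have := h₂ x
          rw [variance_eq_sub (hx x)] at this
          simpa [hh, sub_le_iff_le_add] using this
      _ = _ := by rw [integral_add (integrable_const _) hL.integrable_sq]; simp
  have hkφ : MemLp (fun p : α × β => φ p - k p.2) 2 (μ.prod ν) :=
    hφ.sub (kL.comp_measurePreserving measurePreserving_snd)
  have e₁ : Var[h; μ] ≤ B₁ := by
    rw [variance_eq_integral hL.aestronglyMeasurable.aemeasurable, mean_k]
    calc ∫ x, (h x - ∫ y, k y ∂ν) ^ 2 ∂μ ≤ ∫ x, ∫ y, (φ (x, y) - k y) ^ 2 ∂ν ∂μ := by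
          refine integral_mono (hL.sub (memLp_const _)).integrable_sq
            hkφ.integrable_sq.integral_prod_left fun x => ?_
          have hs := (hx x).sub kL
          have := sq_integral_le_integral_sq hs
          simp only [Pi.sub_apply] at this
          rwa [integral_sub ((hx x).integrable one_le_two) (kL.integrable one_le_two)] at this
      _ = ∫ y, ∫ x, (φ (x, y) - k y) ^ 2 ∂μ ∂ν :=
          integral_integral_swap (f := fun x y => (φ (x, y) - k y) ^ 2) hkφ.integrable_sq
      _ ≤ ∫ _, B₁ ∂ν := by
          refine integral_mono hkφ.integrable_sq.integral_prod_right (integrable_const _)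
            fun y => ?_
          have := h₁ y
          rwa [variance_eq_integral (hy y).aestronglyMeasurable.aemeasurable] at this
      _ = B₁ := by simp
  rw [variance_eq_sub hL] at e₁
  rw [variance_eq_sub hφ]
  simp only [Pi.pow_apply] at e₁ ⊢
  rw [mean_h]
  linarith

end ProductVariance

/-! ### Linear variance bound, one column at a time -/

section ColumnVariance

open ProbabilityTheory

/-- The passage time to `(x + n, m)` when starting from `(x, j)` costs `c j`. -/
noncomputable def weightedCost (c : ℤ → ℝ≥0) (F : Environment) (m : ℤ) (n : ℕ) (x : ℤ) : ℝ≥0 :=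
  ⨅ j : ℤ, (c j + columnCost F m n x j)

theorem weightedCost_le (c : ℤ → ℝ≥0) (F : Environment) (m : ℤ) (n : ℕ) (x j : ℤ) :
    weightedCost c F m n x ≤ c j + columnCost F m n x j :=
  NNReal.iInf_le_apply (fun j => c j + columnCost F m n x j) j

/-- A known first column can be absorbed into the initial costs. General costs `c` are used so that
the induction over columns closes. -/
theorem weightedCost_succ (c : ℤ → ℝ≥0) (F : Environment) (m : ℤ) (n : ℕ) (x : ℤ) :
    weightedCost c F m (n + 1) x =
      weightedCost (fun i => (⨅ j : ℤ, (c j + nndist j i)) + F (x, i)) F m n (x + 1) := by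
  refine le_antisymm (le_ciInf fun i => ?_) (le_ciInf fun j => ?_)
  · rw [add_assoc]
    refine NNReal.le_iInf_add_of_forall_le fun j => (weightedCost_le c F m (n + 1) x j).trans ?_
    rw [add_assoc]
    gcongr
    rw [← add_assoc]
    exact columnCost_succ_le F m n x j i
  · rw [add_comm (c j)]
    refine le_columnCost_succ_add fun i => (weightedCost_le _ F m n (x + 1) i).trans ?_
    have := NNReal.iInf_le_apply (fun j : ℤ => c j + nndist j i) j
    calc _ ≤ (c j + nndist j i) + F (x, i) + columnCost F m n (x + 1) i := by gcongr
      _ = _ := by ring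

theorem measurable_weightedCost (c : ℤ → ℝ≥0) (m : ℤ) (n : ℕ) (x : ℤ) :
    Measurable fun F => weightedCost c F m n x :=
  Measurable.iInf fun j => (measurable_columnCost m n x j).const_add _

theorem memLp_weightedCost (G : Measure ℝ≥0) [IsProbabilityMeasure G] (c : ℤ → ℝ≥0) (m : ℤ)
    (n : ℕ) (x : ℤ) :
    MemLp (fun F => (weightedCost c F m n x : ℝ)) 2 (environmentLaw G) := by
  refine ((memLp_const (c 0 : ℝ)).add (memLp_columnCost G m n x 0)).mono
    (measurable_weightedCost c m n x).coe_nnreal_real.aestronglyMeasurable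
    (Eventually.of_forall fun F => ?_)
  rw [Real.norm_of_nonneg (by positivity), Pi.add_apply, Real.norm_of_nonneg (by positivity)]
  exact_mod_cast weightedCost_le c F m n x 0

theorem weightedCost_replaceColumn (c : ℤ → ℝ≥0) (F F' : Environment) (m : ℤ) (n : ℕ) (x : ℤ) :
    weightedCost c (replaceColumn x F F') m (n + 1) x =
      weightedCost (fun i => (⨅ j : ℤ, (c j + nndist j i)) + F' (x, i)) F m n (x + 1) := by
  rw [weightedCost_succ]
  refine iInf_congr fun i => ?_
  congr 1
  · simp [replaceColumn]
  · refine columnCost_congr (fun z hz => ?_) i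
    simp [replaceColumn, show z.1 ≠ x by lia]

/-- A bound for the second moment of the increment of the passage time caused by one column. -/
noncomputable def columnMoment (G : Measure ℝ≥0) [IsProbabilityMeasure G] : ℝ :=
  ∫ F, (1 + (detourCost F 0 0 : ℝ)) ^ 2 ∂(environmentLaw G)

theorem detourCost_translate (F : Environment) (a b : ℤ) :
    detourCost (fun z => F (z.1 + a, z.2 + b)) 0 0 = detourCost F a b := by
  refine Equiv.iInf_congr (Equiv.addRight b) fun j => ?_
  have : nndist b (j + b) = nndist 0 j := by ext; simp
  simp [this]

theorem integral_detourCost (G : Measure ℝ≥0) [IsProbabilityMeasure G] (x y : ℤ) :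
    ∫ F, (1 + (detourCost F x y : ℝ)) ^ 2 ∂(environmentLaw G) = columnMoment G := by
  have := integral_reindex G ((Equiv.addRight x).prodCongr (Equiv.addRight y))
    (((measurable_detourCost 0 0).coe_nnreal_real.const_add 1).pow_const 2)
  rw [columnMoment, ← this]
  simp only [← detourCost_translate _ x y]
  rfl

theorem le_weightedCost_replaceColumn (c : ℤ → ℝ≥0) (F F' : Environment) (m : ℤ) (n : ℕ)
    (x : ℤ) :
    weightedCost c F m n (x + 1) ≤ weightedCost c (replaceColumn x F F') m (n + 1) x := by
  refine le_ciInf fun j => (weightedCost_le c F m n (x + 1) j).trans ?_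
  gcongr
  refine le_trans (le_of_eq ?_) (columnCost_le_columnCost_succ_left _ m n x j)
  exact columnCost_congr (fun z hz => by simp [replaceColumn, show z.1 ≠ x by lia]) j

theorem weightedCost_replaceColumn_le (c : ℤ → ℝ≥0) (F F' : Environment) (m : ℤ) (n : ℕ)
    (x j : ℤ) :
    weightedCost c (replaceColumn x F F') m (n + 1) x ≤
      detourCost F' x j + (c j + columnCost F m n (x + 1) j) := by
  refine (weightedCost_le c _ m (n + 1) x j).trans ?_
  rw [add_left_comm]
  gcongr
  refine (columnCost_succ_le_detourCost_add _ m n x j).trans (le_of_eq ?_)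
  congr 1
  · simp [detourCost, replaceColumn]
  · exact columnCost_congr (fun z hz => by simp [replaceColumn, show z.1 ≠ x by lia]) j

theorem memLp_weightedCost_replaceColumn (G : Measure ℝ≥0) [IsProbabilityMeasure G]
    (c : ℤ → ℝ≥0) (F : Environment) (m : ℤ) (n : ℕ) (x : ℤ) :
    MemLp (fun F' => (weightedCost c (replaceColumn x F F') m (n + 1) x : ℝ)) 2
      (environmentLaw G) := by
  refine ((memLp_detourCost G x 0).add
    (memLp_const ((c 0 + columnCost F m n (x + 1) 0 : ℝ≥0) : ℝ))).mono
    (((measurable_weightedCost c m (n + 1) x).comp ((measurable_replaceColumn x).comp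
      measurable_prodMk_left)).coe_nnreal_real.aestronglyMeasurable)
    (Eventually.of_forall fun F' => ?_)
  rw [Real.norm_of_nonneg (by positivity), Pi.add_apply, Real.norm_of_nonneg (by positivity)]
  exact_mod_cast weightedCost_replaceColumn_le c F F' m n x 0

/-- Let `w` be the cost with column `x` removed and `j` a starting height within `1` of attaining
it; neither depends on `F'`. The column adds between `0` and `1 + detourCost F' x j`, whose second
moment is the same for all `x` and `j`. -/
theorem variance_weightedCost_replaceColumn_le (G : Measure ℝ≥0) [IsProbabilityMeasure G]
    (c : ℤ → ℝ≥0) (F : Environment) (m : ℤ) (n : ℕ) (x : ℤ) :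
    Var[fun F' => (weightedCost c (replaceColumn x F F') m (n + 1) x : ℝ); environmentLaw G] ≤
      columnMoment G := by
  have hL := memLp_weightedCost_replaceColumn G c F m n x
  set w := weightedCost c F m n (x + 1) with hw
  obtain ⟨j, hj⟩ : ∃ j, c j + columnCost F m n (x + 1) j < w + 1 :=
    exists_lt_of_ciInf_lt (lt_add_of_pos_right _ one_pos)
  rw [← variance_sub_const hL.aestronglyMeasurable (w : ℝ), ← integral_detourCost G x j]
  have hL' := hL.sub (memLp_const (w : ℝ))
  have hd := (memLp_const (1 : ℝ)).add (memLp_detourCost G x j)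
  refine (variance_le_expectation_sq hL'.aestronglyMeasurable).trans
    (integral_mono hL'.integrable_sq hd.integrable_sq fun F' => ?_)
  have h₁ : (w : ℝ) ≤ weightedCost c (replaceColumn x F F') m (n + 1) x :=
    NNReal.coe_le_coe.2 (le_weightedCost_replaceColumn c F F' m n x)
  have h₂ : (weightedCost c (replaceColumn x F F') m (n + 1) x : ℝ) ≤
      detourCost F' x j + (w + 1) := by
    exact_mod_cast (weightedCost_replaceColumn_le c F F' m n x j).trans
      (add_le_add_right hj.le _)
  refine pow_le_pow_left₀ (sub_nonneg.2 h₁) ?_ 2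
  linarith

theorem variance_weightedCost_le (G : Measure ℝ≥0) [IsProbabilityMeasure G] (c : ℤ → ℝ≥0)
    (m : ℤ) (n : ℕ) (x : ℤ) :
    Var[fun F => (weightedCost c F m n x : ℝ); environmentLaw G] ≤ n * columnMoment G := by
  induction n generalizing c x with
  | zero =>
    simp only [weightedCost, columnCost_zero]
    rw [variance_eq_integral aemeasurable_const]
    simp
  | succ n ih =>
    have hp := measurePreserving_replaceColumn G x
    have hX := memLp_weightedCost G c m (n + 1) x
    rw [← hp.variance_fun_comp hX.aestronglyMeasurable.aemeasurable]
    push_cast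
    rw [add_mul, one_mul]
    refine variance_prod_le (hX.comp_measurePreserving hp) (fun F => ?_) (fun F' => ?_)
      (fun F' => ?_) fun F => ?_
    · exact memLp_weightedCost_replaceColumn G c F m n x
    · simp only [Function.comp_apply, weightedCost_replaceColumn]
      exact memLp_weightedCost G _ m n (x + 1)
    · simp only [Function.comp_apply, weightedCost_replaceColumn]
      exact ih _ _
    · exact variance_weightedCost_replaceColumn_le G c F m n x

end ColumnVariance

/-! ### Mean passage times: subadditivity, symmetry, convexity -/

section MeanCost

open ProbabilityTheory

/-- The mean passage time from the origin to `(n, m)`. -/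
noncomputable def meanCost (G : Measure ℝ≥0) [IsProbabilityMeasure G] (n : ℕ) (m : ℤ) : ℝ :=
  ∫ F, (columnCost F m n 0 0 : ℝ) ∂(environmentLaw G)

variable (G : Measure ℝ≥0) [IsProbabilityMeasure G]

theorem integrable_columnCost (m : ℤ) (n : ℕ) (x y : ℤ) :
    Integrable (fun F => (columnCost F m n x y : ℝ)) (environmentLaw G) :=
  (memLp_columnCost G m n x y).integrable one_le_two

theorem meanCost_nonneg (n : ℕ) (m : ℤ) : 0 ≤ meanCost G n m :=
  integral_nonneg fun _ => NNReal.coe_nonneg _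

theorem meanCost_le_add_abs (n : ℕ) (m m' : ℤ) :
    meanCost G n m ≤ meanCost G n m' + |(m : ℝ) - m'| := by
  have : ∫ F, ((columnCost F m' n 0 0 : ℝ) + |(m : ℝ) - m'|) ∂(environmentLaw G) =
      meanCost G n m' + |(m : ℝ) - m'| := by
    rw [integral_add (integrable_columnCost G _ _ _ _) (integrable_const _)]
    simp [meanCost]
  rw [← this]
  refine integral_mono (integrable_columnCost G _ _ _ _)
    ((integrable_columnCost G _ _ _ _).add (integrable_const _)) fun F => ?_
  have := NNReal.coe_le_coe.2 (columnCost_target_le F m m' n 0 0)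
  simpa [Int.dist_eq] using this

theorem integral_columnCost_translate (a b m : ℤ) (n : ℕ) :
    ∫ F, (columnCost F (m + b) n a b : ℝ) ∂(environmentLaw G) = meanCost G n m := by
  have := integral_reindex G ((Equiv.addRight a).prodCongr (Equiv.addRight b))
    (measurable_columnCost m n 0 0).coe_nnreal_real
  rw [meanCost, ← this]
  congr 1
  ext F
  have := columnCost_translate F a b m n 0 0
  rw [zero_add, zero_add] at this
  rw [← this]
  rfl

theorem meanCost_neg (n : ℕ) (m : ℤ) : meanCost G n (-m) = meanCost G n m := by
  have := integral_reindex G ((Equiv.refl ℤ).prodCongr (Equiv.neg ℤ))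
    (measurable_columnCost m n 0 0).coe_nnreal_real
  rw [meanCost, meanCost, ← this]
  congr 1
  ext F
  have := columnCost_reflect F m n 0 0
  rw [neg_zero] at this
  rw [← this]
  rfl

theorem meanCost_add_le (n n' : ℕ) (m m' : ℤ) :
    meanCost G (n + n') (m + m') ≤ meanCost G n m + meanCost G n' m' := by
  rw [← integral_columnCost_translate G n m m' n', add_comm m' m, meanCost, meanCost,
    ← integral_add (integrable_columnCost G _ _ _ _) (integrable_columnCost G _ _ _ _)]
  refine integral_mono (integrable_columnCost G _ _ _ _)
    ((integrable_columnCost G _ _ _ _).add (integrable_columnCost G _ _ _ _)) fun F => ?_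
  have := columnCost_add_le F m (m + m') n n' 0 0
  rw [zero_add] at this
  exact_mod_cast this

theorem exists_tendsto_meanCost_div (v : ℝ) :
    ∃ L : ℝ, Tendsto (fun n : ℕ => meanCost G n ⌈v * n⌉ / n) atTop (𝓝 L) := by
  -- The added `1` absorbs the rounding error of the ceilings.
  have hs : Subadditive fun n : ℕ => meanCost G n ⌈v * n⌉ + 1 := fun n n' => by
    have h₁ := meanCost_le_add_abs G (n + n') ⌈v * ((n + n' : ℕ) : ℝ)⌉ (⌈v * n⌉ + ⌈v * n'⌉)
    have h₂ := meanCost_add_le G n n' ⌈v * n⌉ ⌈v * n'⌉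
    have h₃ : |((⌈v * ((n + n' : ℕ) : ℝ)⌉ : ℤ) : ℝ) - ((⌈v * n⌉ + ⌈v * n'⌉ : ℤ) : ℝ)| ≤ 1 := by
      push_cast
      rw [mul_add]
      have := Int.ceil_add_le (v * n) (v * n')
      have := Int.ceil_add_ceil_le (v * n) (v * n')
      exact_mod_cast (by grind : |⌈v * (n : ℝ) + v * n'⌉ - (⌈v * (n : ℝ)⌉ + ⌈v * (n' : ℝ)⌉)| ≤ 1)
    linarith
  have hb : BddBelow (Set.range fun n : ℕ => (meanCost G n ⌈v * n⌉ + 1) / n) :=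
    ⟨0, by
      rintro _ ⟨n, rfl⟩
      exact div_nonneg (add_nonneg (meanCost_nonneg G _ _) zero_le_one) n.cast_nonneg⟩
  refine ⟨hs.lim, ?_⟩
  have := (hs.tendsto_lim hb).sub tendsto_one_div_atTop_nhds_zero_nat
  rw [sub_zero] at this
  exact this.congr fun n => by ring

/-- The limit of the normalized mean passage times in the direction of slope `v`. -/
noncomputable def meanTimeConstant (v : ℝ) : ℝ :=
  (exists_tendsto_meanCost_div G v).choose

theorem tendsto_meanCost_div (v : ℝ) :
    Tendsto (fun n : ℕ => meanCost G n ⌈v * n⌉ / n) atTop (𝓝 (meanTimeConstant G v)) :=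
  (exists_tendsto_meanCost_div G v).choose_spec

theorem meanTimeConstant_neg (v : ℝ) : meanTimeConstant G (-v) = meanTimeConstant G v := by
  have le (w : ℝ) : meanTimeConstant G (-w) ≤ meanTimeConstant G w := by
    have h := (tendsto_meanCost_div G w).add tendsto_one_div_atTop_nhds_zero_nat
    rw [add_zero] at h
    refine le_of_tendsto_of_tendsto' (tendsto_meanCost_div G _) h fun n => ?_
    rw [← add_div]
    gcongr
    rw [← meanCost_neg G n ⌈w * n⌉]
    refine (meanCost_le_add_abs G n _ _).trans (add_le_add_right ?_ _)
    rw [neg_mul, Int.ceil_neg]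
    have := Int.ceil_le_floor_add_one (w * n)
    have := Int.floor_le_ceil (w * n)
    exact_mod_cast (by grind : |-⌊w * (n : ℝ)⌋ - -⌈w * (n : ℝ)⌉| ≤ 1)
  exact (le v).antisymm (by simpa using le (-v))

/-- Concatenate paths of slope `v` over a fraction `a` of the columns and of slope `w` over the
others. -/
theorem convexOn_meanTimeConstant : ConvexOn ℝ Set.univ (meanTimeConstant G) := by
  refine convexOn_iff_forall_pos.2 ⟨convex_univ, fun v _ w _ a b ha hb hab => ?_⟩
  simp only [smul_eq_mul]
  set k : ℕ → ℕ := fun n => ⌊a * n⌋₊ with hk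
  have hkn (n : ℕ) : k n ≤ n := by
    refine Nat.floor_le_of_le (mul_le_of_le_one_left n.cast_nonneg (by linarith))
  have hka : Tendsto (fun n : ℕ => (k n : ℝ) / n) atTop (𝓝 a) :=
    (tendsto_nat_floor_mul_div_atTop ha.le).comp tendsto_natCast_atTop_atTop
  have hlb : Tendsto (fun n : ℕ => ((n - k n : ℕ) : ℝ) / n) atTop (𝓝 b) := by
    have : Tendsto (fun n : ℕ => 1 - (k n : ℝ) / n) atTop (𝓝 b) := by
      rw [show b = 1 - a by linarith]
      exact hka.const_sub 1
    refine this.congr' ?_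
    filter_upwards [eventually_ne_atTop 0] with n hn
    rw [Nat.cast_sub (hkn n)]
    field_simp
  have aux {u : ℕ → ℕ} {r : ℝ} (hr : 0 < r) (hu : Tendsto (fun n : ℕ => (u n : ℝ) / n) atTop (𝓝 r))
      (s : ℝ) : Tendsto (fun n : ℕ => meanCost G (u n) ⌈s * u n⌉ / n) atTop
        (𝓝 (r * meanTimeConstant G s)) := by
    have hu' : Tendsto u atTop atTop := by
      have := hu.pos_mul_atTop hr tendsto_natCast_atTop_atTop
      rw [← tendsto_natCast_atTop_iff (R := ℝ)]
      refine this.congr' ?_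
      filter_upwards [eventually_ne_atTop 0] with n hn
      field_simp
    refine (hu.mul ((tendsto_meanCost_div G s).comp hu')).congr' ?_
    filter_upwards [hu'.eventually_ne_atTop 0] with n hn
    simp only [Function.comp_apply]
    field_simp
  -- Rounding `a * n` down moves the endpoint by at most `|v| + |w|`, and each of three ceilings by
  -- at most `1`.
  set C : ℝ := |v| + |w| + 3 with hC
  have hlim : Tendsto (fun n : ℕ => meanCost G (k n) ⌈v * k n⌉ / n +
      meanCost G (n - k n) ⌈w * (n - k n : ℕ)⌉ / n + C * (1 / (n : ℝ))) atTop
      (𝓝 (a * meanTimeConstant G v + b * meanTimeConstant G w + C * 0)) :=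
    ((aux ha hka v).add (aux hb hlb w)).add (tendsto_one_div_atTop_nhds_zero_nat.const_mul C)
  rw [mul_zero, add_zero] at hlim
  refine le_of_tendsto_of_tendsto' (tendsto_meanCost_div G _) hlim fun n => ?_
  rw [mul_one_div, ← add_div, ← add_div]
  gcongr
  have h₁ := meanCost_add_le G (k n) (n - k n) ⌈v * k n⌉ ⌈w * (n - k n : ℕ)⌉
  rw [Nat.add_sub_cancel' (hkn n)] at h₁
  have h₂ := meanCost_le_add_abs G n ⌈(a * v + b * w) * n⌉ (⌈v * k n⌉ + ⌈w * (n - k n : ℕ)⌉)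
  have h₃ : |((⌈(a * v + b * w) * n⌉ : ℤ) : ℝ) - ((⌈v * k n⌉ + ⌈w * (n - k n : ℕ)⌉ : ℤ) : ℝ)| ≤ C := by
    have hf₁ := Nat.floor_le (mul_nonneg ha.le n.cast_nonneg : 0 ≤ a * (n : ℝ))
    have hf₂ := Nat.lt_floor_add_one (a * (n : ℝ))
    rw [Nat.cast_sub (hkn n)]
    push_cast
    set θ : ℝ := a * n - k n with hθ
    have hθ₁ : |θ| ≤ 1 := abs_le.2 ⟨by simp only [hθ, hk]; linarith, by simp only [hθ, hk]; linarith⟩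
    have hv : |v * θ| ≤ |v| := by
      rw [abs_mul]
      exact mul_le_of_le_one_right (abs_nonneg _) hθ₁
    have hw : |w * θ| ≤ |w| := by
      rw [abs_mul]
      exact mul_le_of_le_one_right (abs_nonneg _) hθ₁
    have key : (a * v + b * w) * n = v * k n + w * (n - k n) + v * θ - w * θ := by
      rw [show b = 1 - a by linarith, hθ]; ring
    have c₁ := Int.le_ceil ((a * v + b * w) * n)
    have c₂ := Int.ceil_lt_add_one ((a * v + b * w) * n)
    have c₃ := Int.le_ceil (v * k n)
    have c₄ := Int.ceil_lt_add_one (v * k n)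
    have c₅ := Int.le_ceil (w * ((n : ℝ) - k n))
    have c₆ := Int.ceil_lt_add_one (w * ((n : ℝ) - k n))
    rw [abs_le] at hv hw ⊢
    constructor <;> linarith
  linarith

/-! ### Almost sure convergence -/

theorem variance_columnCost_le (m : ℤ) (n : ℕ) :
    Var[fun F => (columnCost F m n 0 0 : ℝ); environmentLaw G] ≤ n * columnMoment G := by
  convert variance_weightedCost_le G (fun j => nndist 0 j) m n 0 using 3 with F
  refine le_antisymm (le_ciInf fun j => columnCost_le_nndist_add F m n 0 0 j) ?_
  simpa using weightedCost_le (fun j => nndist 0 j) F m n 0 0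

/-- Random variables with summable variances converge to their means. -/
theorem ae_tendsto_sub_integral {Ω : Type*} [MeasurableSpace Ω] {μ : Measure Ω}
    [IsProbabilityMeasure μ] {X : ℕ → Ω → ℝ} (hX : ∀ k, MemLp (X k) 2 μ)
    (hm : ∀ k, Measurable (X k)) (hs : Summable fun k => Var[X k; μ]) :
    ∀ᵐ ω ∂μ, Tendsto (fun k => X k ω - ∫ ω', X k ω' ∂μ) atTop (𝓝 0) := by
  have hlt : ∫⁻ ω, ∑' k, ENNReal.ofReal ((X k ω - ∫ ω', X k ω' ∂μ) ^ 2) ∂μ ≠ ⊤ := by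
    rw [lintegral_tsum fun k => (((hm k).sub_const _).pow_const 2).ennreal_ofReal.aemeasurable]
    simp_rw [← evariance_eq_lintegral_ofReal, ← fun k => ofReal_variance (hX k)]
    rw [← ENNReal.ofReal_tsum_of_nonneg (fun k => variance_nonneg _ _) hs]
    exact ENNReal.ofReal_ne_top
  filter_upwards [ae_lt_top' (AEMeasurable.tsum fun k =>
    (((hm k).sub_const _).pow_const 2).ennreal_ofReal.aemeasurable) hlt] with ω hω
  have h₁ := ENNReal.tendsto_atTop_zero_of_tsum_ne_top hω.ne
  have h₂ := (ENNReal.tendsto_toReal ENNReal.zero_ne_top).comp h₁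
  have h₃ : Tendsto (fun k => √((X k ω - ∫ ω', X k ω' ∂μ) ^ 2)) atTop (𝓝 √0) := by
    refine (Real.continuous_sqrt.tendsto 0).comp (h₂.congr fun k => ?_)
    simp [ENNReal.toReal_ofReal (sq_nonneg _)]
  rw [Real.sqrt_zero] at h₃
  simp only [Real.sqrt_sq_eq_abs] at h₃
  exact (tendsto_zero_iff_abs_tendsto_zero _).2 h₃

/-- Along `n = k ^ 2` the normalized variance is at most a constant over `k ^ 2`, hence summable. -/
theorem ae_tendsto_columnCost_div_sq (v : ℝ) :
    ∀ᵐ F ∂(environmentLaw G), Tendsto (fun k : ℕ =>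
      (columnCost F ⌈v * ((k ^ 2 : ℕ) : ℝ)⌉ (k ^ 2) 0 0 : ℝ) / ((k ^ 2 : ℕ) : ℝ)) atTop
      (𝓝 (meanTimeConstant G v)) := by
  have hs : Summable fun k : ℕ => Var[fun F =>
      ((k ^ 2 : ℕ) : ℝ)⁻¹ * (columnCost F ⌈v * ((k ^ 2 : ℕ) : ℝ)⌉ (k ^ 2) 0 0 : ℝ);
      environmentLaw G] := by
    refine Summable.of_nonneg_of_le (fun k => variance_nonneg _ _) (fun k => ?_)
      ((Real.summable_one_div_nat_pow.2 one_lt_two).mul_right (columnMoment G))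
    rw [variance_const_mul]
    refine (mul_le_mul_of_nonneg_left (variance_columnCost_le G _ _) (sq_nonneg _)).trans
      (le_of_eq ?_)
    rcases eq_or_ne k 0 with rfl | hk
    · simp
    · push_cast
      field_simp
  have h := ae_tendsto_sub_integral (fun k => (memLp_columnCost G _ _ _ _).const_mul _)
    (fun k => (measurable_columnCost _ _ _ _).coe_nnreal_real.const_mul _) hs
  filter_upwards [h] with F hF
  have hsq : Tendsto (fun k : ℕ => k ^ 2) atTop atTop := tendsto_pow_atTop two_ne_zero
  have := hF.add ((tendsto_meanCost_div G v).comp hsq)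
  rw [zero_add] at this
  refine this.congr fun k => ?_
  rw [integral_const_mul]
  simp only [Function.comp_apply, meanCost]
  ring

theorem ae_tendsto_columnCost_div (v : ℝ) :
    ∀ᵐ F ∂(environmentLaw G), Tendsto (fun n : ℕ => (columnCost F ⌈v * (n : ℝ)⌉ n 0 0 : ℝ) / n)
      atTop (𝓝 (meanTimeConstant G v)) := by
  filter_upwards [ae_tendsto_columnCost_div_sq G v] with F hF
  set L : ℕ := ⌈|v|⌉₊ with hL
  have hvL : |v| ≤ L := Nat.le_ceil _
  -- One more column does not lower the cost to a fixed height, and the target height moves by at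
  -- most `L`. Adding `L * n` makes the sequence monotone, and consecutive squares have ratio
  -- tending to `1`.
  have hmono : Monotone fun n : ℕ => (columnCost F ⌈v * (n : ℝ)⌉ n 0 0 : ℝ) + L * n := by
    refine monotone_nat_of_le_succ fun n => ?_
    have h₁ := (columnCost_target_le F ⌈v * (n : ℝ)⌉ ⌈v * ((n + 1 : ℕ) : ℝ)⌉ n 0 0).trans
      (add_le_add_left (columnCost_le_columnCost_succ F _ n 0 0) _)
    rw [← NNReal.coe_le_coe, NNReal.coe_add, coe_nndist, Int.dist_eq] at h₁
    have h₂ : |((⌈v * (n : ℝ)⌉ : ℤ) : ℝ) - (⌈v * ((n + 1 : ℕ) : ℝ)⌉ : ℤ)| ≤ L := by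
      rw [abs_le] at hvL
      have c₁ : ⌈v * (n : ℝ)⌉ ≤ ⌈v * ((n + 1 : ℕ) : ℝ)⌉ + L := Int.ceil_le.2 <| by
        have := Int.le_ceil (v * ((n + 1 : ℕ) : ℝ))
        push_cast at this ⊢
        linarith
      have c₂ : ⌈v * ((n + 1 : ℕ) : ℝ)⌉ ≤ ⌈v * (n : ℝ)⌉ + L := Int.ceil_le.2 <| by
        have := Int.le_ceil (v * (n : ℝ))
        push_cast at this ⊢
        linarith
      have c₁' : (⌈v * (n : ℝ)⌉ : ℝ) ≤ ⌈v * ((n + 1 : ℕ) : ℝ)⌉ + L := by exact_mod_cast c₁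
      have c₂' : (⌈v * ((n + 1 : ℕ) : ℝ)⌉ : ℝ) ≤ ⌈v * (n : ℝ)⌉ + L := by exact_mod_cast c₂
      exact abs_le.2 ⟨by linarith, by linarith⟩
    push_cast at h₁ h₂ ⊢
    linarith
  have key := tendsto_div_of_monotone_of_exists_subseq_tendsto_div _ (meanTimeConstant G v + L)
    hmono fun a ha => ⟨fun k => k ^ 2, ?_, tendsto_pow_atTop two_ne_zero, ?_⟩
  · have := key.sub_const (L : ℝ)
    rw [add_sub_cancel_right] at this
    refine this.congr' ?_
    filter_upwards [eventually_ne_atTop 0] with n hn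
    field_simp
    ring
  · have h₁ : Tendsto (fun n : ℕ => (1 + 1 / (n : ℝ)) ^ 2) atTop (𝓝 ((1 + 0) ^ 2)) :=
      (tendsto_one_div_atTop_nhds_zero_nat.const_add 1).pow 2
    rw [add_zero, one_pow] at h₁
    filter_upwards [h₁.eventually_le_const ha, eventually_gt_atTop 0] with n h hn
    have hn' : (0 : ℝ) < n := by exact_mod_cast hn
    push_cast
    calc ((n : ℝ) + 1) ^ 2 = (1 + 1 / (n : ℝ)) ^ 2 * n ^ 2 := by field_simp
      _ ≤ _ := by gcongr
  · refine (hF.add_const (L : ℝ)).congr' ?_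
    filter_upwards [eventually_ne_atTop 0] with n hn
    field_simp

theorem isTimeConstant_meanTimeConstant (v : ℝ) : IsTimeConstant G v (meanTimeConstant G v) := by
  simp only [IsTimeConstant, passageTime_eq_columnCost]
  exact ae_tendsto_columnCost_div G v

/-- The value picked by `epsilon` is unique: two almost sure limits occur together in some
environment. -/
theorem timeConstant_eq_meanTimeConstant : timeConstant G = meanTimeConstant G := by
  ext v
  have h₁ := isTimeConstant_meanTimeConstant G |v|
  have h₂ : IsTimeConstant G |v| (timeConstant G v) := Classical.epsilon_spec ⟨_, h₁⟩
  obtain ⟨F, hF₁, hF₂⟩ := (h₁.and h₂).exists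
  rw [tendsto_nhds_unique hF₂ hF₁]
  rcases abs_choice v with h | h <;> rw [h]
  exact meanTimeConstant_neg G v

end MeanCost

/-! ### The derivative bounds -/

theorem measurePreserving_shear (G : Measure ℝ≥0) [IsProbabilityMeasure G] (s : ℤ) :
    MeasurePreserving (shear s) (environmentLaw G) (environmentLaw G) :=
  measurePreserving_reindex G
    { toFun := fun z => (z.1, z.2 - s * (z.1 + 1))
      invFun := fun z => (z.1, z.2 + s * (z.1 + 1))
      left_inv := fun z => by simp
      right_inv := fun z => by simp }

theorem card_range_filter_div_le (n : ℕ) (P : ℕ → Prop) [DecidablePred P] :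
    (((Finset.range (n + 1)).filter P).card : ℝ) / n ≤ 2 := by
  rcases Nat.eq_zero_or_pos n with rfl | hn
  · simp
  · have h := Finset.card_filter_le (Finset.range (n + 1)) P
    rw [Finset.card_range] at h
    rw [div_le_iff₀ (by exact_mod_cast hn)]
    exact_mod_cast (by lia : ((Finset.range (n + 1)).filter P).card ≤ 2 * n)

/-- For a non-deterministic weight distribution `G` on `[0, ∞)` the time constant exists, it has
one-sided derivatives at every `v ≥ 0`, and almost surely these are bounded through the numbers of
turns of the geodesics from the origin to `(n, ⌈v n⌉)`, however the geodesics are chosen. -/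
theorem mainTheorem2 (G : MeasureTheory.Measure ℝ≥0) [MeasureTheory.IsProbabilityMeasure G]
    (hG : ∀ c : ℝ≥0, G ≠ MeasureTheory.Measure.dirac c) :
    (∀ v : ℝ, 0 ≤ v → IsTimeConstant G v (timeConstant G v)) ∧
    ∀ v : ℝ, 0 ≤ v →
      DifferentiableWithinAt ℝ (timeConstant G) (Set.Ioi v) v ∧
      DifferentiableWithinAt ℝ (timeConstant G) (Set.Iio v) v ∧
      ∀ᵐ F ∂(environmentLaw G),
        ∀ γ : (n : ℕ) → latticeGraph.Walk (0, 0) ((n : ℤ), ⌈v * (n : ℝ)⌉),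
          (∀ n : ℕ, IsSemiDirected (γ n) ∧ IsGeodesic F (γ n)) →
          derivWithin (timeConstant G) (Set.Ioi v) v ≤
            liminf (fun n : ℕ => ((upTurns (γ n) : ℝ) + (rightTurns (γ n) : ℝ)
              - (downTurns (γ n) : ℝ)) / (n : ℝ)) atTop ∧
          limsup (fun n : ℕ => ((upTurns (γ n) : ℝ) - (rightTurns (γ n) : ℝ)
              - (downTurns (γ n) : ℝ)) / (n : ℝ)) atTop ≤
            derivWithin (timeConstant G) (Set.Iio v) v := by
  rw [timeConstant_eq_meanTimeConstant]
  refine ⟨fun v _ => isTimeConstant_meanTimeConstant G v, fun v _ => ?_⟩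
  have hc := convexOn_meanTimeConstant G
  have hv : v ∈ interior (Set.univ : Set ℝ) := by simp
  refine ⟨hc.differentiableWithinAt_Ioi_of_mem_interior hv,
    hc.differentiableWithinAt_Iio_of_mem_interior hv, ?_⟩
  -- The three events do not involve `γ`, so one null set serves all choices of geodesics.
  filter_upwards [ae_tendsto_columnCost_div G v,
    (measurePreserving_shear G 1).quasiMeasurePreserving.ae (ae_tendsto_columnCost_div G (v + 1)),
    (measurePreserving_shear G (-1)).quasiMeasurePreserving.ae
      (ae_tendsto_columnCost_div G (v - 1))] with F h₀ h₁ h₂ γ hγ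
  have hT (n : ℕ) : pathTime F (γ n) = columnCost F ⌈v * (n : ℝ)⌉ n 0 0 :=
    (hγ n).2.trans (passageTime_eq_columnCost F n _)
  -- Real `liminf` and `limsup` can be compared only for bounded sequences; `s = 1` and `s = -1`
  -- give the two that occur.
  have hbdd (n : ℕ) (s : ℝ) (hs : |s| ≤ 1) :
      |((upTurns (γ n) : ℝ) + s * rightTurns (γ n) - downTurns (γ n)) / n| ≤ 6 := by
    have bU : (upTurns (γ n) : ℝ) / n ≤ 2 := card_range_filter_div_le n _
    have bR : (rightTurns (γ n) : ℝ) / n ≤ 2 := card_range_filter_div_le n _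
    have bD : (downTurns (γ n) : ℝ) / n ≤ 2 := card_range_filter_div_le n _
    have pU : 0 ≤ (upTurns (γ n) : ℝ) / n := by positivity
    have pR : 0 ≤ (rightTurns (γ n) : ℝ) / n := by positivity
    have pD : 0 ≤ (downTurns (γ n) : ℝ) / n := by positivity
    have hsR : |s * ((rightTurns (γ n) : ℝ) / n)| ≤ 2 := by
      rw [abs_mul, abs_of_nonneg pR]
      exact (mul_le_of_le_one_left pR hs).trans bR
    rw [sub_div, add_div, mul_div_assoc]
    rw [abs_le] at hsR ⊢
    constructor <;> linarith
  have hbdd₁ (n : ℕ) := abs_le.1 (by simpa using hbdd n 1 (by simp))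
  have hbdd₂ (n : ℕ) := abs_le.1 (by simpa [← sub_eq_add_neg] using hbdd n (-1) (by simp))
  constructor
  -- By convexity the right derivative is at most the slope over `[v, v + 1]`, which is the limit of
  -- the sheared minus the original passage time, divided by `n`.
  · have hslope := hc.rightDeriv_le_slope_of_mem_interior hv (Set.mem_univ (v + 1)) (by simp)
    have hlim := (h₁.sub h₀).sub tendsto_one_div_atTop_nhds_zero_nat
    rw [sub_zero] at hlim
    refine (hslope.trans (le_of_eq ?_)).trans (hlim.liminf_eq.symm.le.trans
      (liminf_le_liminf (Eventually.of_forall fun n => ?_) hlim.isBoundedUnder_ge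
        (isBoundedUnder_of ⟨6, fun n => (hbdd₁ n).2⟩ : IsBoundedUnder (· ≤ ·) atTop _).isCoboundedUnder_ge))
    · simp [slope_def_field]
    · have := columnCost_shear_one_le F (γ n) (hγ n).1
      rw [hT, ← Int.ceil_add_natCast, ← add_one_mul] at this
      rw [← sub_div, ← sub_div]
      exact div_le_div_of_nonneg_right (by linarith) n.cast_nonneg
  · have hslope := hc.slope_le_leftDeriv_of_mem_interior (Set.mem_univ (v - 1)) hv (by simp)
    have hlim := (h₀.sub h₂).add tendsto_one_div_atTop_nhds_zero_nat
    rw [add_zero] at hlim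
    refine le_trans (le_trans (limsup_le_limsup (Eventually.of_forall fun n => ?_)
      (isBoundedUnder_of ⟨-6, fun n => (hbdd₂ n).1⟩ :
        IsBoundedUnder (· ≥ ·) atTop _).isCoboundedUnder_le hlim.isBoundedUnder_le)
      hlim.limsup_eq.le) (le_trans (le_of_eq ?_) hslope)
    · have := columnCost_shear_neg_one_le F (γ n) (hγ n).1
      rw [hT, ← Int.ceil_sub_natCast, ← sub_one_mul] at this
      rw [← sub_div, ← add_div]
      exact div_le_div_of_nonneg_right (by linarith) n.cast_nonneg
    · simp [slope_def_field]
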